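/- Let $X$ be a real or complex Banach space and let $A$ generate a $C_0$-semigroup $(T(t))_{t\ge 0}$ on $X$ that is exponentially stable: $\|T(t)\|\le M e^{-\delta t}$ for all $t\ge 0$, with some constants $M$ and $\delta>0$. For $1\le p<\infty$, a (strongly) measurable, locally $p$-integrable function $u:\mathbb R\to X$ is called $S^p$-almost periodic if for every $\varepsilon>0$ the set of $\tau\in\mathbb R$ with $\sup_{x\in\mathbb R}\big(\int_x^{x+1}\|u(t+\tau)-u(t)\|^p\,dt\big)^{1/p}\le\varepsilon$ is relatively dense, that is, meets every interval of some fixed length $\ell>0$. For $p=\infty$ the $L^p$-norm is replaced by the essential supremum. A continuous $u$ is Bohr almost periodic if for every $\varepsilon>0$ the set of $\tau$ with $\sup_{t}\|u(t+\tau)-u(t)\|<\varepsilon$ is relatively dense. It is purely Stepanov almost periodic (of order $p$) if it is $S^p$-almost periodic but not Bohr almost periodic. Let $1\le p,q<\infty$ and $1\le r\le\infty$ with $\frac1p=\frac1q+\frac1r$, and let $f:\mathbb R\times X\to X$ be such that $f(\cdot,x)$ is $S^p$-almost periodic for every $x\in X$ and such that (Lip) there is a measurable $L:\mathbb R\to[0,\infty)$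 with $\sup_{x\in\mathbb R}\|L\|_{L^r(x,x+1)}<\infty$ and $\|f(t,u)-f(t,v)\|\le L(t)\|u-v\|$ for all $t\in\mathbb R$, $u,v\in X$. For $u:\mathbb R\to X$ put $(\Gamma u)(t)=\int_{-\infty}^t T(t-s)f(s,u(s))\,ds$. Then: 1. If $u$ is $S^q$-almost periodic, then the integral defining $(\Gamma u)(t)$ converges absolutely for every $t\in\mathbb R$ and $\Gamma u$ is Bohr almost periodic. 2. If $\frac1p+\frac1r\le 1$ (for instance if $p\ge 2$, or if $r=\infty$), then the same holds for every $S^p$-almost periodic $u$. 3. Let $u:\mathbb R\to X$ be a bounded mild solution of $u'=Au+f(t,u)$ on $\mathbb R$, that is, a bounded continuous function with $u(t)=T(t-a)u(a)+\int_a^tT(t-s)f(s,u(s))\,ds$ for all $a\le t$ (the integrals being absolutely convergent). Then $u$ is not purely Stepanov almost periodic of any order $s\in[1,\infty]$: if $u$ is $S^s$-almost periodic for some such $s$, then it is Bohr almost periodic. -/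

import Mathlib

open MeasureTheory Filter Topology Set
open scoped ENNReal

noncomputable section

namespace StepanovAP

/-- A set of reals is relatively dense if it meets every interval of some fixed length. -/
def RelDense (S : Set ℝ) : Prop :=
  ∃ l : ℝ, 0 < l ∧ ∀ a : ℝ, (S ∩ Icc a (a + l)).Nonempty

section Functions

variable {E : Type*} [NormedAddCommGroup E]

/-- Bohr almost periodicity: continuity, and for every `ε > 0` a relatively dense set of
`ε`-almost periods for the uniform distance. -/
def IsBohrAP (f : ℝ → E) : Prop :=
  Continuous f ∧ ∀ ε : ℝ, 0 < ε →
    RelDense {τ : ℝ | ⨆ t : ℝ, edist (f t) (f (t + τ)) < ENNReal.ofReal ε}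

/-- The Stepanov distance of order `p`:
the supremum over `x` of the `L^p` distance on `[x, x + 1]`
(for `p = ∞` this is the essential supremum distance on `ℝ`). -/
def stepanovDist (p : ℝ≥0∞) (f g : ℝ → E) : ℝ≥0∞ :=
  ⨆ x : ℝ, eLpNorm (fun t => f t - g t) p (volume.restrict (Icc x (x + 1)))

/-- Locally `p`-integrable functions on the line. -/
def IsLocLp (p : ℝ≥0∞) (f : ℝ → E) : Prop :=
  ∀ a b : ℝ, MemLp f p (volume.restrict (Icc a b))

/-- Stepanov boundedness: membership in `S^p(ℝ, E)`. -/
def IsStepanovBounded (p : ℝ≥0∞) (f : ℝ → E) : Prop :=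
  AEStronglyMeasurable f volume ∧ stepanovDist p f (fun _ => 0) < ∞

/-- Stepanov almost periodicity of order `p`. -/
def IsStepanovAP (p : ℝ≥0∞) (f : ℝ → E) : Prop :=
  IsLocLp p f ∧ ∀ ε : ℝ, 0 < ε →
    RelDense {τ : ℝ | stepanovDist p (fun t => f (t + τ)) f ≤ ENNReal.ofReal ε}

/-- Stepanov almost periodic of order `p`, but not Bohr almost periodic. -/
def IsPurelyStepanovAP (p : ℝ≥0∞) (f : ℝ → E) : Prop :=
  IsStepanovAP p f ∧ ¬ IsBohrAP f

/-- A parametric function is Stepanov almost periodic of order `p` if every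
`f(·, x)` is. -/
def IsParamStepanovAP {X : Type*} (p : ℝ≥0∞) (f : ℝ → X → E) : Prop :=
  ∀ x : X, IsStepanovAP p (fun t => f t x)

/-- Condition (Lip) with exponent `r`. -/
def LipCondition (r : ℝ≥0∞) (f : ℝ → E → E) : Prop :=
  ∃ L : ℝ → ℝ, (∀ t, 0 ≤ L t) ∧ IsStepanovBounded r L ∧
    ∀ (t : ℝ) (u v : E), ‖f t u - f t v‖ ≤ L t * ‖u - v‖

end Functions

section Semigroups

variable {X : Type*} [NormedAddCommGroup X] [NormedSpace ℝ X]

/-- `(T(t))_{t ≥ 0}` is a strongly continuous semigroup of bounded operators; the values of `T`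
at negative times play no role. -/
structure IsC0Semigroup (T : ℝ → X →L[ℝ] X) : Prop where
  map_zero : T 0 = ContinuousLinearMap.id ℝ X
  map_add : ∀ s t : ℝ, 0 ≤ s → 0 ≤ t → T (s + t) = (T s).comp (T t)
  tendsto_zero : ∀ x : X, Tendsto (fun t => T t x) (𝓝[>] 0) (𝓝 x)

/-- The (possibly unbounded) operator `A` is the infinitesimal generator of `T`: `x ∈ Dom A` and
`A x = y` exactly when `(T(h) x - x) / h → y` as `h → 0+`. -/
def IsGenerator (A : X →ₗ.[ℝ] X) (T : ℝ → X →L[ℝ] X) : Prop :=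
  ∀ x y : X, (∃ hx : x ∈ A.domain, A ⟨x, hx⟩ = y) ↔
    Tendsto (fun h : ℝ => h⁻¹ • (T h x - x)) (𝓝[>] 0) (𝓝 y)

/-- Exponential stability of the semigroup. -/
def IsExpStable (T : ℝ → X →L[ℝ] X) : Prop :=
  ∃ M δ : ℝ, 0 < δ ∧ ∀ t : ℝ, 0 ≤ t → ‖T t‖ ≤ M * Real.exp (-δ * t)

/-- `(Γ u)(t) = ∫_{-∞}^t T(t - s) f(s, u(s)) ds`. -/
def gammaOp (T : ℝ → X →L[ℝ] X) (f : ℝ → X → X) (u : ℝ → X) (t : ℝ) : X :=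
  ∫ s in Iic t, T (t - s) (f s (u s))

/-- The integral defining `(Γ u)(t)` converges absolutely for every `t`. -/
def GammaDefined (T : ℝ → X →L[ℝ] X) (f : ℝ → X → X) (u : ℝ → X) : Prop :=
  ∀ t : ℝ, IntegrableOn (fun s => T (t - s) (f s (u s))) (Iic t) volume

/-- `u` is a mild solution on the whole line of `u' = A u + f(t, u)`, where `A` generates `T`. -/
def IsMildSolution (T : ℝ → X →L[ℝ] X) (f : ℝ → X → X) (u : ℝ → X) : Prop :=
  Continuous u ∧ ∀ a t : ℝ, a ≤ t →
    IntervalIntegrable (fun s => T (t - s) (f s (u s))) volume a t ∧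
    u t = T (t - a) (u a) + ∫ s in a..t, T (t - s) (f s (u s))

end Semigroups

end StepanovAP

end

open StepanovAP

/-! Superposition: if `u` is `S^q`-almost periodic, then `s ↦ f s (u s)` is `S^p`-almost periodic.
For finite `q`, `u` is `S^q`-close to taking values in a finite set `F`. For a common almost period
`τ` of `u` and of the finitely many `f(·, x)`, `x ∈ F`, the Lipschitz condition and Hölder's
inequality (1/p = 1/q + 1/r) control the difference of the compositions (`IsParamStepanovAP.comp`).
Common almost periods exist because almost periodicity of finite order is total boundedness of the
line for a translation invariant pseudometric, a property stable under finite sums (`IsTotBdd.add`).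
Convolution with the exponentially decaying semigroup is bounded from `S^1` to the uniform norm and
commutes with translations, so it turns Stepanov into Bohr almost periodicity
(`IsStepanovAP.convolution`). For bounded functions all finite Stepanov orders agree
(`IsStepanovAP.of_bounded`), and a bounded mild solution satisfies `u = Γ u`; hence the third claim
follows from the first. -/

namespace StepanovAP

/-! ### Translation invariant pseudometrics and common almost periods -/

/-- A translation invariant extended pseudometric on the line, given as a function of the
difference of its arguments. -/
structure IsGauge (φ : ℝ → ℝ≥0∞) : Prop where
  neg : ∀ x, φ (-x) ≤ φ x
  add_le : ∀ x y, φ (x + y) ≤ φ x + φ y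

/-- Total boundedness of the line for the pseudometric `φ (x - y)`. -/
def IsTotBdd (φ : ℝ → ℝ≥0∞) : Prop :=
  ∀ ε : ℝ≥0∞, ε ≠ 0 → ∃ F : Set ℝ, F.Finite ∧ ∀ x : ℝ, ∃ c ∈ F, φ (x - c) ≤ ε

theorem IsGauge.add {φ ψ : ℝ → ℝ≥0∞} (hφ : IsGauge φ) (hψ : IsGauge ψ) :
    IsGauge (fun x => φ x + ψ x) where
  neg x := add_le_add (hφ.neg x) (hψ.neg x)
  add_le x y := (add_le_add (hφ.add_le x y) (hψ.add_le x y)).trans_eq (by ring)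

/-- Intersecting the cells of a `φ`-net with those of a `ψ`-net leaves finitely many cells; one
point chosen in each nonempty cell gives a net for the sum. Radius `ε / 4` makes two points of a
cell `ε / 2`-close for each gauge. -/
theorem IsTotBdd.add {φ ψ : ℝ → ℝ≥0∞} (hφ : IsGauge φ) (hψ : IsGauge ψ)
    (bφ : IsTotBdd φ) (bψ : IsTotBdd ψ) : IsTotBdd (fun x => φ x + ψ x) := by
  classical
  intro ε hε
  have hε4 : ε / 2 / 2 ≠ 0 := by simp [ENNReal.div_eq_zero_iff, hε]
  obtain ⟨F, hF, hFc⟩ := bφ _ hε4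
  obtain ⟨G, hG, hGc⟩ := bψ _ hε4
  let P : ℝ × ℝ → ℝ → Prop := fun c y => φ (y - c.1) ≤ ε / 2 / 2 ∧ ψ (y - c.2) ≤ ε / 2 / 2
  -- The value 0 on empty cells is harmless: the cell used for `x` contains `x`.
  let rep : ℝ × ℝ → ℝ := fun c => if h : ∃ y, P c y then h.choose else 0
  refine ⟨rep '' (F ×ˢ G), (hF.prod hG).image _, fun x => ?_⟩
  obtain ⟨c, hc, hxc⟩ := hFc x
  obtain ⟨d, hd, hxd⟩ := hGc x
  refine ⟨rep (c, d), ⟨(c, d), ⟨hc, hd⟩, rfl⟩, ?_⟩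
  have hex : ∃ y, P (c, d) y := ⟨x, hxc, hxd⟩
  have hrep : P (c, d) (rep (c, d)) := by
    simp only [rep, dif_pos hex]
    exact hex.choose_spec
  have key : ∀ {χ : ℝ → ℝ≥0∞}, IsGauge χ → ∀ a y : ℝ, χ (x - a) ≤ ε / 2 / 2 →
      χ (y - a) ≤ ε / 2 / 2 → χ (x - y) ≤ ε / 2 := by
    intro χ hχ a y h1 h2
    calc χ (x - y) = χ ((x - a) + -(y - a)) := by congr 1; ring
      _ ≤ χ (x - a) + χ (-(y - a)) := hχ.add_le _ _
      _ ≤ ε / 2 / 2 + ε / 2 / 2 := add_le_add h1 ((hχ.neg _).trans h2)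
      _ = ε / 2 := ENNReal.add_halves _
  calc _ ≤ ε / 2 + ε / 2 :=
        add_le_add (key hφ c _ hxc hrep.1) (key hψ d _ hxd hrep.2)
    _ = ε := ENNReal.add_halves _

theorem IsGauge.sum {ι : Type*} (s : Finset ι) {φ : ι → ℝ → ℝ≥0∞} (hφ : ∀ i, IsGauge (φ i)) :
    IsGauge (fun x => ∑ i ∈ s, φ i x) where
  neg x := Finset.sum_le_sum fun i _ => (hφ i).neg x
  add_le x y := by
    rw [← Finset.sum_add_distrib]
    exact Finset.sum_le_sum fun i _ => (hφ i).add_le x y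

theorem IsTotBdd.sum {ι : Type*} (s : Finset ι) {φ : ι → ℝ → ℝ≥0∞} (hφ : ∀ i, IsGauge (φ i))
    (bφ : ∀ i, IsTotBdd (φ i)) : IsTotBdd (fun x => ∑ i ∈ s, φ i x) := by
  classical
  induction s using Finset.induction_on with
  | empty => exact fun ε _ => ⟨{0}, finite_singleton 0, fun x => ⟨0, rfl, by simp⟩⟩
  | insert i s hi ih =>
    simp only [Finset.sum_insert hi]
    exact IsTotBdd.add (hφ i) (IsGauge.sum s hφ) (bφ i) ih

theorem IsTotBdd.relDense {φ : ℝ → ℝ≥0∞} (bφ : IsTotBdd φ) {ε : ℝ≥0∞} (hε : ε ≠ 0) :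
    RelDense {τ | φ τ ≤ ε} := by
  obtain ⟨F, hF, hFc⟩ := bφ ε hε
  obtain ⟨R, hR, hFR⟩ := hF.isBounded.exists_pos_norm_le
  refine ⟨2 * R, by positivity, fun a => ?_⟩
  obtain ⟨c, hc, h⟩ := hFc (a + R)
  have := abs_le.1 (hFR c hc)
  exact ⟨a + R - c, h, by constructor <;> linarith⟩

/-- An almost period moves any point into the compact interval `[0, l]`, which continuity at 0
covers by finitely many small balls. -/
theorem IsGauge.isTotBdd {φ : ℝ → ℝ≥0∞} (hφ : IsGauge φ) (h0 : Tendsto φ (𝓝 0) (𝓝 0))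
    (hd : ∀ ε : ℝ≥0∞, ε ≠ 0 → RelDense {τ | φ τ ≤ ε}) : IsTotBdd φ := by
  intro ε hε
  have hε2 : ε / 2 ≠ 0 := by simp [ENNReal.div_eq_zero_iff, hε]
  obtain ⟨l, hl, hld⟩ := hd _ hε2
  have h0' : ∀ᶠ x in 𝓝 0, φ x ≤ ε / 2 := h0.eventually (ge_mem_nhds (pos_iff_ne_zero.2 hε2))
  obtain ⟨η, hη, hηb⟩ := Metric.eventually_nhds_iff.1 h0'
  obtain ⟨F, -, hF, hFc⟩ := finite_cover_balls_of_compact (isCompact_Icc (a := (0 : ℝ)) (b := l)) hη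
  refine ⟨F, hF, fun x => ?_⟩
  obtain ⟨τ, hτ, hτx⟩ := hld (x - l)
  have hmem : x - τ ∈ Icc 0 l := by constructor <;> linarith [hτx.1, hτx.2]
  obtain ⟨c, hc, hcx⟩ := mem_iUnion₂.1 (hFc hmem)
  refine ⟨c, hc, ?_⟩
  calc φ (x - c) = φ ((x - τ - c) + τ) := by congr 1; ring
    _ ≤ φ (x - τ - c) + φ τ := hφ.add_le _ _
    _ ≤ ε / 2 + ε / 2 := by
        refine add_le_add (hηb ?_) hτ
        simpa [dist_eq_norm] using hcx
    _ = ε := ENNReal.add_halves _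

/-! ### The Stepanov norm: Hölder inequality and translations -/

section Norm

variable {E G : Type*} [NormedAddCommGroup E] [NormedAddCommGroup G]

/-- The Stepanov norm of order `p`. -/
noncomputable def stepanovNorm (p : ℝ≥0∞) (h : ℝ → E) : ℝ≥0∞ :=
  ⨆ x : ℝ, eLpNorm h p (volume.restrict (Icc x (x + 1)))

instance isProbabilityMeasure_restrict_Icc (x : ℝ) :
    IsProbabilityMeasure (volume.restrict (Icc x (x + 1))) :=
  ⟨by simp⟩

theorem eLpNorm_le_stepanovNorm (p : ℝ≥0∞) (h : ℝ → E) (x : ℝ) :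
    eLpNorm h p (volume.restrict (Icc x (x + 1))) ≤ stepanovNorm p h :=
  le_iSup (fun x : ℝ => eLpNorm h p (volume.restrict (Icc x (x + 1)))) x

theorem stepanovNorm_mono {p : ℝ≥0∞} {h : ℝ → E} {k : ℝ → G} (hk : ∀ t, ‖h t‖ ≤ ‖k t‖) :
    stepanovNorm p h ≤ stepanovNorm p k :=
  iSup_mono fun _ => eLpNorm_mono hk

theorem stepanovNorm_add_le {p : ℝ≥0∞} (hp : 1 ≤ p) {h k : ℝ → E}
    (hh : AEStronglyMeasurable h volume) (hk : AEStronglyMeasurable k volume) :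
    stepanovNorm p (fun t => h t + k t) ≤ stepanovNorm p h + stepanovNorm p k :=
  iSup_le fun x => (eLpNorm_add_le hh.restrict hk.restrict hp).trans
    (add_le_add (eLpNorm_le_stepanovNorm p h x) (eLpNorm_le_stepanovNorm p k x))

theorem stepanovNorm_sum_le {p : ℝ≥0∞} (hp : 1 ≤ p) {ι : Type*} (s : Finset ι) {h : ι → ℝ → E}
    (hh : ∀ i, AEStronglyMeasurable (h i) volume) :
    stepanovNorm p (fun t => ∑ i ∈ s, h i t) ≤ ∑ i ∈ s, stepanovNorm p (h i) := by
  refine iSup_le fun x => ?_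
  have := eLpNorm_sum_le (s := s) (μ := volume.restrict (Icc x (x + 1)))
    (fun i _ => (hh i).restrict) hp
  refine le_trans (le_of_eq ?_) (this.trans (Finset.sum_le_sum fun i _ =>
    eLpNorm_le_stepanovNorm p (h i) x))
  congr 1
  ext t
  simp

theorem stepanovNorm_le_of_exponent_le {p q : ℝ≥0∞} (hpq : p ≤ q) {h : ℝ → E}
    (hh : AEStronglyMeasurable h volume) : stepanovNorm p h ≤ stepanovNorm q h :=
  iSup_mono fun _ => eLpNorm_le_eLpNorm_of_exponent_le hpq hh.restrict

theorem stepanovNorm_le_mul {p q r : ℝ≥0∞} [hpqr : ENNReal.HolderTriple r q p] {L : ℝ → ℝ}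
    {v : ℝ → G} {h : ℝ → E} (hL : AEStronglyMeasurable L volume)
    (hv : AEStronglyMeasurable v volume) (hh : ∀ t, ‖h t‖ ≤ ‖L t‖ * ‖v t‖) :
    stepanovNorm p h ≤ stepanovNorm r L * stepanovNorm q v := by
  refine iSup_le fun x => ?_
  calc eLpNorm h p (volume.restrict (Icc x (x + 1)))
      ≤ eLpNorm (L • fun t => ‖v t‖) p (volume.restrict (Icc x (x + 1))) := by
        refine eLpNorm_mono fun t => (hh t).trans_eq ?_
        simp
    _ ≤ eLpNorm L r (volume.restrict (Icc x (x + 1))) *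
        eLpNorm (fun t => ‖v t‖) q (volume.restrict (Icc x (x + 1))) :=
        eLpNorm_smul_le_mul_eLpNorm hv.norm.restrict hL.restrict
    _ ≤ stepanovNorm r L * stepanovNorm q v := by
        rw [eLpNorm_norm]
        exact mul_le_mul' (eLpNorm_le_stepanovNorm _ _ _) (eLpNorm_le_stepanovNorm _ _ _)

theorem aestronglyMeasurable_comp_add_right {h : ℝ → E} (hh : AEStronglyMeasurable h volume)
    (τ : ℝ) : AEStronglyMeasurable (fun t => h (t + τ)) volume :=
  hh.comp_quasiMeasurePreserving (measurePreserving_add_right volume τ).quasiMeasurePreserving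

theorem eLpNorm_comp_add_right_Icc (p : ℝ≥0∞) (h : ℝ → E) (τ a b : ℝ) :
    eLpNorm (fun t => h (t + τ)) p (volume.restrict (Icc a b)) =
      eLpNorm h p (volume.restrict (Icc (a + τ) (b + τ))) := by
  have he := measurableEmbedding_addRight τ
  have hm := (measurePreserving_add_right volume τ).restrict_preimage_emb he
    (Icc (a + τ) (b + τ))
  have hpre : (fun x => x + τ) ⁻¹' Icc (a + τ) (b + τ) = Icc a b := by
    ext; simp
  rw [hpre] at hm
  rw [← hm.map_eq, he.eLpNorm_map_measure]
  rfl

theorem stepanovNorm_comp_add_right (p : ℝ≥0∞) (h : ℝ → E) (τ : ℝ) :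
    stepanovNorm p (fun t => h (t + τ)) = stepanovNorm p h := by
  apply le_antisymm
  · refine iSup_le fun x => ?_
    rw [eLpNorm_comp_add_right_Icc, add_right_comm]
    exact eLpNorm_le_stepanovNorm _ _ _
  · refine iSup_le fun x => ?_
    have := eLpNorm_le_stepanovNorm p (fun t => h (t + τ)) (x - τ)
    rw [eLpNorm_comp_add_right_Icc, sub_add_cancel, sub_add_eq_add_sub, sub_add_cancel] at this
    exact this

theorem isGauge_stepanovDist {p : ℝ≥0∞} (hp : 1 ≤ p) {f : ℝ → E}
    (hf : AEStronglyMeasurable f volume) :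
    IsGauge (fun τ => stepanovDist p (fun t => f (t + τ)) f) where
  neg τ := by
    change stepanovNorm p (fun t => f (t + -τ) - f t) ≤ stepanovNorm p (fun t => f (t + τ) - f t)
    rw [← stepanovNorm_comp_add_right p (fun t => f (t + -τ) - f t) τ]
    refine stepanovNorm_mono fun t => ?_
    rw [add_neg_cancel_right, norm_sub_rev]
  add_le σ τ := by
    change stepanovNorm p (fun t => f (t + (σ + τ)) - f t) ≤
      stepanovNorm p (fun t => f (t + σ) - f t) + stepanovNorm p (fun t => f (t + τ) - f t)
    rw [← stepanovNorm_comp_add_right p (fun t => f (t + σ) - f t) τ]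
    have hm := aestronglyMeasurable_comp_add_right hf
    refine le_trans (stepanovNorm_mono fun t => le_of_eq ?_)
      (stepanovNorm_add_le hp
        (aestronglyMeasurable_comp_add_right ((hm σ).sub hf) τ) ((hm τ).sub hf))
    congr 1
    rw [show t + (σ + τ) = t + τ + σ by ring]
    abel

end Norm

theorem RelDense.mono {S S' : Set ℝ} (hS : RelDense S) (h : S ⊆ S') : RelDense S' := by
  obtain ⟨l, hl, H⟩ := hS
  exact ⟨l, hl, fun a => (H a).mono (inter_subset_inter_left _ h)⟩

theorem exists_ofReal_le {ε : ℝ≥0∞} (hε : ε ≠ 0) : ∃ δ : ℝ, 0 < δ ∧ ENNReal.ofReal δ ≤ ε := by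
  rcases eq_or_ne ε ∞ with rfl | h
  · exact ⟨1, one_pos, le_top⟩
  · exact ⟨ε.toReal, ENNReal.toReal_pos hε h, (ENNReal.ofReal_toReal h).le⟩

/-! ### Stepanov almost periodic functions: boundedness, continuity of translations, nearly finite
range -/

section Norm

variable {E : Type*} [NormedAddCommGroup E]

theorem aestronglyMeasurable_of_Icc {f : ℝ → E}
    (h : ∀ a b : ℝ, AEStronglyMeasurable f (volume.restrict (Icc a b))) :
    AEStronglyMeasurable f volume := by
  have hU : (⋃ n : ℕ, Icc (-(n : ℝ)) n) = univ := by
    refine eq_univ_of_forall fun x => ?_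
    obtain ⟨n, hn⟩ := exists_nat_ge |x|
    exact mem_iUnion.2 ⟨n, abs_le.1 hn⟩
  rw [← Measure.restrict_univ (μ := (volume : Measure ℝ)), ← hU]
  exact aestronglyMeasurable_iUnion_iff.2 fun n => h _ _

theorem IsStepanovAP.aestronglyMeasurable {p : ℝ≥0∞} {f : ℝ → E} (hf : IsStepanovAP p f) :
    AEStronglyMeasurable f volume :=
  aestronglyMeasurable_of_Icc fun a b => (hf.1 a b).1

theorem IsStepanovAP.relDense {p : ℝ≥0∞} {f : ℝ → E} (hf : IsStepanovAP p f) {ε : ℝ≥0∞}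
    (hε : ε ≠ 0) : RelDense {τ | stepanovDist p (fun t => f (t + τ)) f ≤ ε} := by
  obtain ⟨δ, hδ, hδε⟩ := exists_ofReal_le hε
  exact (hf.2 δ hδ).mono fun τ hτ => le_trans hτ hδε

theorem RelDense.exists_add_mem_Icc {S : Set ℝ} (hS : RelDense S) :
    ∃ l : ℝ, 0 < l ∧ ∀ x : ℝ, ∃ τ ∈ S, x + τ ∈ Icc 0 l := by
  obtain ⟨l, hl, H⟩ := hS
  refine ⟨l, hl, fun x => ?_⟩
  obtain ⟨τ, hτ, h⟩ := H (-x)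
  exact ⟨τ, hτ, by constructor <;> linarith [h.1, h.2]⟩

theorem eLpNorm_comp_add_right_le {p : ℝ≥0∞} (k : ℝ → E) {x τ l : ℝ} (h : x + τ ∈ Icc 0 l) :
    eLpNorm (fun t => k (t + τ)) p (volume.restrict (Icc x (x + 1))) ≤
      eLpNorm k p (volume.restrict (Icc 0 (l + 1))) := by
  rw [eLpNorm_comp_add_right_Icc]
  refine eLpNorm_mono_measure _ (Measure.restrict_mono (Icc_subset_Icc h.1 ?_) le_rfl)
  linarith [h.2]

/-- A function whose values are controlled by its translates along the almost periods of `f` has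
its Stepanov norm controlled on a compact interval. -/
theorem IsStepanovAP.exists_stepanovNorm_le {p : ℝ≥0∞} (hp : 1 ≤ p) {f : ℝ → E}
    (hf : IsStepanovAP p f) {ε : ℝ≥0∞} (hε : ε ≠ 0) :
    ∃ l : ℝ, 0 < l ∧ ∀ k : ℝ → ℝ, AEStronglyMeasurable k volume →
      (∀ t, 0 ≤ k t) → (∀ s t, k t ≤ ‖f s - f t‖ + k s) →
      stepanovNorm p k ≤ ε + eLpNorm k p (volume.restrict (Icc 0 (l + 1))) := by
  -- An almost period carries every window `[x, x + 1]` into `[0, l + 1]`, at cost at most `ε`.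
  obtain ⟨l, hl, H⟩ := (hf.relDense hε).exists_add_mem_Icc
  refine ⟨l, hl, fun k hkm hk0 hk => iSup_le fun x => ?_⟩
  obtain ⟨τ, hτ, hx⟩ := H x
  have hm := aestronglyMeasurable_comp_add_right hf.aestronglyMeasurable τ
  calc eLpNorm k p (volume.restrict (Icc x (x + 1)))
      ≤ eLpNorm ((fun t => ‖f (t + τ) - f t‖) + fun t => k (t + τ)) p
          (volume.restrict (Icc x (x + 1))) := by
        refine eLpNorm_mono_real fun t => ?_
        rw [Real.norm_of_nonneg (hk0 t)]
        exact hk (t + τ) t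
    _ ≤ _ := eLpNorm_add_le (hm.sub hf.aestronglyMeasurable).norm.restrict
        (aestronglyMeasurable_comp_add_right hkm τ).restrict hp
    _ ≤ ε + eLpNorm k p (volume.restrict (Icc 0 (l + 1))) := by
        refine add_le_add ?_ (eLpNorm_comp_add_right_le k hx)
        rw [eLpNorm_norm]
        exact (eLpNorm_le_stepanovNorm p (fun t => f (t + τ) - f t) x).trans hτ

theorem IsStepanovAP.stepanovNorm_lt_top {p : ℝ≥0∞} (hp : 1 ≤ p) {f : ℝ → E}
    (hf : IsStepanovAP p f) : stepanovNorm p f < ∞ := by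
  obtain ⟨l, -, H⟩ := hf.exists_stepanovNorm_le hp one_ne_zero
  have h := H (fun t => ‖f t‖) hf.aestronglyMeasurable.norm (fun t => norm_nonneg _)
    (fun s t => by
      have := norm_sub_norm_le (f t) (f s)
      rw [norm_sub_rev] at this
      linarith)
  rw [eLpNorm_norm] at h
  calc stepanovNorm p f ≤ stepanovNorm p (fun t => ‖f t‖) := stepanovNorm_mono fun t => by simp
    _ ≤ _ := h
    _ < ∞ := ENNReal.add_lt_top.2 ⟨ENNReal.one_lt_top, (hf.1 _ _).2⟩

/-- Continuity of translations in `L^p`. -/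
theorem tendsto_eLpNorm_comp_add_right {p : ℝ≥0∞} (hp : 1 ≤ p) (hp' : p ≠ ∞) {f : ℝ → E}
    (hf : MemLp f p volume) :
    Tendsto (fun σ => eLpNorm (fun t => f (t + σ) - f t) p volume) (𝓝 0) (𝓝 0) := by
  have : Fact (1 ≤ p) := ⟨hp⟩
  -- Currying makes the translations a continuous family in the compact-open topology, so continuity
  -- of composition with measure preserving maps on `L^p` applies at 0.
  let g : ℝ → C(ℝ, ℝ) := fun σ => ⟨fun t => t + σ, by fun_prop⟩
  have hg : Continuous g := by
    have : Continuous (Function.uncurry fun σ t : ℝ => t + σ) := by fun_prop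
    exact (ContinuousMap.curry ⟨_, this⟩).continuous
  have hmp : ∀ σ, MeasurePreserving (g σ) volume volume := fun σ =>
    measurePreserving_add_right volume σ
  have key := (tendsto_const_nhds (x := hf.toLp f)).compMeasurePreservingLp (hg.tendsto 0) hmp
    (hmp 0) hp'
  rw [tendsto_iff_edist_tendsto_0] at key
  refine key.congr fun σ => ?_
  rw [Lp.toLp_compMeasurePreserving, Lp.toLp_compMeasurePreserving, Lp.edist_toLp_toLp]
  congr 1
  ext t
  simp [g]

/-- Shifting by an almost period reduces the supremum over all windows to the single interval `[0, l
+ 1]`, where `L^p`-continuity of translations suffices. -/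
theorem IsStepanovAP.tendsto_stepanovDist {p : ℝ≥0∞} (hp : 1 ≤ p) (hp' : p ≠ ∞) {f : ℝ → E}
    (hf : IsStepanovAP p f) :
    Tendsto (fun σ => stepanovDist p (fun t => f (t + σ)) f) (𝓝 0) (𝓝 0) := by
  have hfm := hf.aestronglyMeasurable
  have htr := aestronglyMeasurable_comp_add_right hfm
  refine ENNReal.tendsto_nhds_zero.2 fun ε hε => ?_
  have hε2 : ε / 2 / 2 ≠ 0 := by simp [ENNReal.div_eq_zero_iff, hε.ne']
  obtain ⟨l, hl, H⟩ := (hf.relDense hε2).exists_add_mem_Icc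
  -- The margin of length 1 keeps both `t` and `t + σ` inside for `t ∈ [0, l + 1]` and `|σ| ≤ 1`, so
  -- truncation does not alter the difference there.
  have hw : MemLp (indicator (Icc (-1) (l + 2)) f) p volume :=
    (memLp_indicator_iff_restrict measurableSet_Icc).2 (hf.1 _ _)
  have h1 := ENNReal.tendsto_nhds_zero.1 (tendsto_eLpNorm_comp_add_right hp hp' hw) (ε / 2)
    (by simp [hε.ne'])
  have h2 : ∀ᶠ σ : ℝ in 𝓝 0, σ ∈ Icc (-1 : ℝ) 1 := Icc_mem_nhds (by norm_num) (by norm_num)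
  filter_upwards [h1, h2] with σ hσ hσ1
  refine iSup_le fun x => ?_
  obtain ⟨τ, hτ, hx⟩ := H x
  have hm1 : AEStronglyMeasurable (fun t => ‖f (t + σ + τ) - f (t + σ)‖) volume :=
    aestronglyMeasurable_comp_add_right (h := fun t => ‖f (t + τ) - f t‖)
      ((htr τ).sub hfm).norm σ
  have hm2 : AEStronglyMeasurable (fun t => ‖f (t + τ) - f t‖) volume := ((htr τ).sub hfm).norm
  have hm3 : AEStronglyMeasurable (fun t => ‖f (t + τ + σ) - f (t + τ)‖) volume :=
    aestronglyMeasurable_comp_add_right (h := fun t => ‖f (t + σ) - f t‖)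
      ((htr σ).sub hfm).norm τ
  have hb2 : stepanovNorm p (fun t => f (t + τ) - f t) ≤ ε / 2 / 2 := hτ
  calc eLpNorm (fun t => f (t + σ) - f t) p (volume.restrict (Icc x (x + 1)))
      ≤ eLpNorm (((fun t => ‖f (t + σ + τ) - f (t + σ)‖) + fun t => ‖f (t + τ) - f t‖) +
          fun t => ‖f (t + τ + σ) - f (t + τ)‖) p (volume.restrict (Icc x (x + 1))) := by
        refine eLpNorm_mono_real fun t => ?_
        simp only [Pi.add_apply]
        rw [show f (t + σ) - f t = (f (t + τ) - f t) + (f (t + τ + σ) - f (t + τ)) -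
          (f (t + σ + τ) - f (t + σ)) by rw [add_right_comm t τ σ]; abel]
        linarith [norm_sub_le ((f (t + τ) - f t) + (f (t + τ + σ) - f (t + τ)))
          (f (t + σ + τ) - f (t + σ)), norm_add_le (f (t + τ) - f t) (f (t + τ + σ) - f (t + τ))]
    _ ≤ eLpNorm (fun t => ‖f (t + σ + τ) - f (t + σ)‖) p (volume.restrict (Icc x (x + 1))) +
        eLpNorm (fun t => ‖f (t + τ) - f t‖) p (volume.restrict (Icc x (x + 1))) +
        eLpNorm (fun t => ‖f (t + τ + σ) - f (t + τ)‖) p (volume.restrict (Icc x (x + 1))) :=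
        (eLpNorm_add_le (hm1.add hm2).restrict hm3.restrict hp).trans
          (add_le_add_left (eLpNorm_add_le hm1.restrict hm2.restrict hp) _)
    _ ≤ ε / 2 / 2 + ε / 2 / 2 + ε / 2 := by
        gcongr
        · refine le_trans (eLpNorm_le_stepanovNorm p _ x) ?_
          rw [stepanovNorm_comp_add_right p (fun t => ‖f (t + τ) - f t‖) σ]
          exact (stepanovNorm_mono fun t => by simp).trans hb2
        · rw [eLpNorm_norm]
          exact (eLpNorm_le_stepanovNorm p _ x).trans hb2
        · refine (eLpNorm_comp_add_right_le (fun t => ‖f (t + σ) - f t‖) hx).trans ?_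
          rw [eLpNorm_norm]
          refine le_trans (le_of_eq ?_) ((eLpNorm_restrict_le _ p volume (Icc 0 (l + 1))).trans hσ)
          refine eLpNorm_congr_ae ((ae_restrict_iff' measurableSet_Icc).2 (ae_of_all _ fun t ht => ?_))
          simp only [mem_Icc] at ht hσ1
          beta_reduce
          rw [indicator_of_mem, indicator_of_mem] <;> constructor <;>
            linarith [ht.1, ht.2, hσ1.1, hσ1.2]
    _ = ε := by rw [ENNReal.add_halves, ENNReal.add_halves]

theorem IsStepanovAP.isTotBdd {p : ℝ≥0∞} (hp : 1 ≤ p) (hp' : p ≠ ∞) {f : ℝ → E}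
    (hf : IsStepanovAP p f) : IsTotBdd (fun τ => stepanovDist p (fun t => f (t + τ)) f) :=
  (isGauge_stepanovDist hp hf.aestronglyMeasurable).isTotBdd (hf.tendsto_stepanovDist hp hp')
    fun _ hε => hf.relDense hε

theorem IsStepanovAP.of_exponent_le {p q : ℝ≥0∞} (hpq : p ≤ q) {f : ℝ → E}
    (hf : IsStepanovAP q f) : IsStepanovAP p f := by
  refine ⟨fun a b => (hf.1 a b).mono_exponent hpq, fun ε hε => (hf.2 ε hε).mono fun τ hτ => ?_⟩
  refine le_trans (stepanovNorm_le_of_exponent_le hpq ?_) hτ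
  exact (aestronglyMeasurable_comp_add_right hf.aestronglyMeasurable τ).sub hf.aestronglyMeasurable

/-- Substitute for precompactness of the range. A simple function approximates `f` on one compact
interval; since the distance to a set is 1-Lipschitz, almost periods propagate the estimate to every
window. The extra point 0 makes nonemptiness immediate. -/
theorem IsStepanovAP.exists_finset_stepanovNorm_infDist_le {p : ℝ≥0∞} (hp : 1 ≤ p) (hp' : p ≠ ∞)
    {f : ℝ → E} (hf : IsStepanovAP p f) {ε : ℝ≥0∞} (hε : ε ≠ 0) :
    ∃ F : Finset E, F.Nonempty ∧ stepanovNorm p (fun t => Metric.infDist (f t) F) ≤ ε := by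
  classical
  have hε2 : ε / 2 ≠ 0 := by simp [hε]
  obtain ⟨l, hl, H⟩ := hf.exists_stepanovNorm_le hp hε2
  obtain ⟨g, hg, -⟩ := (hf.1 0 (l + 1)).exists_simpleFunc_eLpNorm_sub_lt hp' hε2
  refine ⟨insert 0 g.range, Finset.insert_nonempty _ _, ?_⟩
  have hc : Continuous fun x : E => Metric.infDist x (insert 0 g.range : Finset E) :=
    Metric.continuous_infDist_pt _
  refine (H _ (hc.comp_aestronglyMeasurable hf.aestronglyMeasurable)
    (fun t => Metric.infDist_nonneg) fun s t => ?_).trans ?_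
  · rw [norm_sub_rev, ← dist_eq_norm, add_comm]
    exact Metric.infDist_le_infDist_add_dist
  · calc _ ≤ ε / 2 + ε / 2 := by
          gcongr
          refine le_trans (eLpNorm_mono fun t => ?_) hg.le
          rw [Real.norm_of_nonneg Metric.infDist_nonneg, Pi.sub_apply, ← dist_eq_norm]
          exact Metric.infDist_le_dist_of_mem (by simp)
      _ = ε := ENNReal.add_halves _

end Norm

/-! ### Superposition, and independence of the order for bounded functions -/

section Composition

variable {E : Type*} [NormedAddCommGroup E]

/-- A compact interval is covered by finitely many unit windows; the induction adds one window at a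
time. -/
theorem memLp_Icc_of_stepanovNorm_lt_top {p : ℝ≥0∞} {f : ℝ → E}
    (hfm : AEStronglyMeasurable f volume) (hf : stepanovNorm p f < ∞) : IsLocLp p f := by
  have key : ∀ (a : ℝ) (n : ℕ), MemLp f p (volume.restrict (Icc a (a + n))) := by
    intro a n
    induction n with
    | zero => simp
    | succ n ih =>
      have h1 : MemLp f p (volume.restrict (Icc (a + n) (a + n + 1))) :=
        ⟨hfm.restrict, (eLpNorm_le_stepanovNorm p f _).trans_lt hf⟩
      have h2 := ((memLp_indicator_iff_restrict measurableSet_Icc).2 ih.norm).add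
        ((memLp_indicator_iff_restrict measurableSet_Icc).2 h1.norm)
      rw [← memLp_indicator_iff_restrict measurableSet_Icc]
      refine h2.mono (hfm.indicator measurableSet_Icc) (ae_of_all _ fun t => ?_)
      rw [norm_indicator_eq_indicator_norm, Pi.add_apply]
      refine le_trans ?_ (le_abs_self _)
      have n1 : ∀ s : Set ℝ, 0 ≤ indicator s (fun t => ‖f t‖) t := fun s =>
        indicator_nonneg (fun _ _ => norm_nonneg _) _
      by_cases ht : t ∈ Icc a (a + (n + 1 : ℕ))
      · rw [indicator_of_mem ht]
        rcases le_total t (a + n) with h | h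
        · rw [indicator_of_mem (show t ∈ Icc a (a + n) from ⟨ht.1, h⟩)]
          linarith [n1 (Icc (a + n) (a + n + 1))]
        · have h' := ht.2
          push_cast at h'
          rw [indicator_of_mem (show t ∈ Icc (a + n) (a + n + 1) from ⟨h, by linarith⟩)]
          linarith [n1 (Icc a (a + n))]
      · rw [indicator_of_notMem ht]
        exact add_nonneg (n1 _) (n1 _)
  intro a b
  obtain ⟨n, hn⟩ := exists_nat_ge (b - a)
  exact (key a n).mono_measure
    (Measure.restrict_mono (Icc_subset_Icc_right (by linarith)) le_rfl)

/-- Carathéodory functions preserve measurability. -/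
theorem aestronglyMeasurable_superposition {f : ℝ → E → E} {u : ℝ → E}
    (hf : ∀ x, AEStronglyMeasurable (fun t => f t x) volume) (hc : ∀ t, Continuous (f t))
    (hu : AEStronglyMeasurable u volume) :
    AEStronglyMeasurable (fun t => f t (u t)) volume := by
  -- For a simple function the composition is a finite sum over fibres; continuity of `f t` then
  -- passes to the pointwise limit.
  have hs : ∀ s : SimpleFunc ℝ E, AEStronglyMeasurable (fun t => f t (s t)) volume := by
    classical
    intro s
    have : (fun t => f t (s t)) =
        fun t => ∑ y ∈ s.range, indicator (s ⁻¹' {y}) (fun t => f t y) t := by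
      ext t
      rw [Finset.sum_eq_single (s t)]
      · rw [indicator_of_mem (by simp)]
      · intro y _ hy
        exact indicator_of_notMem (fun h => hy (by simpa using h.symm)) _
      · intro h
        exact absurd (s.mem_range_self t) h
    rw [this]
    exact Finset.aestronglyMeasurable_fun_sum _ fun y _ => (hf y).indicator (s.measurableSet_fiber y)
  have hv := hu.stronglyMeasurable_mk
  have h := aestronglyMeasurable_of_tendsto_ae atTop (fun n => hs (hv.approx n))
    (ae_of_all volume fun t => ((hc t).tendsto _).comp (hv.tendsto_approx t))
  refine h.congr ?_
  filter_upwards [hu.ae_eq_mk] with t ht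
  rw [ht]

/-- The superposition theorem for Stepanov almost periodic functions. -/
theorem IsParamStepanovAP.comp {p q r : ℝ≥0∞} (hp : 1 ≤ p) (hp' : p ≠ ∞) (hq : 1 ≤ q) (hq' : q ≠ ∞)
    [hpqr : ENNReal.HolderTriple r q p] {f : ℝ → E → E} (hf : IsParamStepanovAP p f)
    (hLip : LipCondition r f) {u : ℝ → E} (hu : IsStepanovAP q u) :
    IsStepanovAP p (fun t => f t (u t)) := by
  obtain ⟨L, hL0, ⟨hLm, hLb⟩, hL⟩ := hLip
  have hum := hu.aestronglyMeasurable
  have hfm := fun x => (hf x).aestronglyMeasurable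
  have hc : ∀ t, Continuous (f t) := fun t =>
    (LipschitzWith.of_dist_le_mul (K := (L t).toNNReal) fun x y => by
      rw [dist_eq_norm, dist_eq_norm, Real.coe_toNNReal _ (hL0 t)]; exact hL t x y).continuous
  have hgm := aestronglyMeasurable_superposition hfm hc hum
  set K := stepanovNorm r L with hK
  have hKt : K < ∞ := by simpa [stepanovDist] using! hLb
  have hLK : ∀ τ, stepanovNorm r (fun t => L (t + τ)) = K := stepanovNorm_comp_add_right r L
  refine ⟨memLp_Icc_of_stepanovNorm_lt_top hgm ?_, fun ε hε => ?_⟩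
  · calc stepanovNorm p (fun t => f t (u t))
        ≤ stepanovNorm p (fun t => ‖f t 0‖ + L t * ‖u t‖) := by
          refine stepanovNorm_mono fun t => ?_
          rw [Real.norm_of_nonneg (add_nonneg (norm_nonneg _) (mul_nonneg (hL0 t) (norm_nonneg _)))]
          have h1 := hL t (u t) 0
          rw [sub_zero] at h1
          linarith [norm_sub_norm_le (f t (u t)) (f t 0)]
      _ ≤ stepanovNorm p (fun t => ‖f t 0‖) + stepanovNorm p (fun t => L t * ‖u t‖) :=
          stepanovNorm_add_le hp (hfm 0).norm (hLm.mul hum.norm)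
      _ ≤ stepanovNorm p (fun t => f t 0) + K * stepanovNorm q u :=
          add_le_add (stepanovNorm_mono fun t => by simp)
            (stepanovNorm_le_mul (r := r) (q := q) hLm hum fun t => by simp)
      _ < ∞ := ENNReal.add_lt_top.2 ⟨(hf 0).stepanovNorm_lt_top hp,
          ENNReal.mul_lt_top hKt (hu.stepanovNorm_lt_top hq)⟩
  have hK1 : 3 * K + 1 ≠ ∞ := by finiteness
  -- The final bound consists of three Hölder terms `K * δ` and one term `δ`.
  set δ := ENNReal.ofReal ε / (3 * K + 1) with hδ
  have hδ0 : δ ≠ 0 := (ENNReal.div_pos (by simpa using hε) hK1).ne'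
  obtain ⟨F, hFne, hF⟩ := hu.exists_finset_stepanovNorm_infDist_le hq hq' hδ0
  set h : ℝ → ℝ := fun t => Metric.infDist (u t) F with hh
  have hh0 : ∀ t, 0 ≤ h t := fun t => Metric.infDist_nonneg
  have hhm : AEStronglyMeasurable h volume :=
    (Metric.continuous_infDist_pt (F : Set E)).comp_aestronglyMeasurable hum
  have hgauge := fun x => isGauge_stepanovDist hp (hfm x)
  have hdense := (IsTotBdd.add (isGauge_stepanovDist hq hum) (IsGauge.sum F hgauge)
    (hu.isTotBdd hq hq') (IsTotBdd.sum F hgauge fun x => (hf x).isTotBdd hp hp')).relDense hδ0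
  refine hdense.mono fun τ hτ => ?_
  have hu1 : stepanovNorm q (fun t => u (t + τ) - u t) ≤ δ := le_trans le_self_add hτ
  have hf1 : ∑ x ∈ F, stepanovNorm p (fun t => f (t + τ) x - f t x) ≤ δ := le_trans le_add_self hτ
  have hLτ := aestronglyMeasurable_comp_add_right hLm τ
  have hum' := (aestronglyMeasurable_comp_add_right hum τ).sub hum
  have hfm' : ∀ x, AEStronglyMeasurable (fun t => ‖f (t + τ) x - f t x‖) volume := fun x =>
    ((aestronglyMeasurable_comp_add_right (hfm x) τ).sub (hfm x)).norm
  have hm1 : AEStronglyMeasurable (fun t => L (t + τ) * ‖u (t + τ) - u t‖) volume :=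
    hLτ.mul hum'.norm
  have hm2 : AEStronglyMeasurable (fun t => L (t + τ) * h t) volume := hLτ.mul hhm
  have hm3 : AEStronglyMeasurable (fun t => L t * h t) volume := hLm.mul hhm
  have hm4 : AEStronglyMeasurable (fun t => ∑ x ∈ F, ‖f (t + τ) x - f t x‖) volume :=
    Finset.aestronglyMeasurable_fun_sum _ fun x _ => hfm' x
  change stepanovNorm p (fun t => f (t + τ) (u (t + τ)) - f t (u t)) ≤ ENNReal.ofReal ε
  calc stepanovNorm p (fun t => f (t + τ) (u (t + τ)) - f t (u t))
      ≤ stepanovNorm p (fun t => L (t + τ) * ‖u (t + τ) - u t‖ + L (t + τ) * h t + L t * h t +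
          ∑ x ∈ F, ‖f (t + τ) x - f t x‖) := by
        refine stepanovNorm_mono fun t => le_trans ?_ (le_abs_self _)
        -- The point `x` of `F` nearest to `u t` depends on `t`; bounding its term by the sum over
        -- all of `F` removes this dependence.
        obtain ⟨x, hx, hxd⟩ := F.finite_toSet.isCompact.exists_infDist_eq_dist hFne (u t)
        have hxh : ‖u t - x‖ = h t := by rw [hh, ← dist_eq_norm, ← hxd]
        have e1 := hL (t + τ) (u (t + τ)) (u t)
        have e2 := hL (t + τ) (u t) x
        have e3 := hL t (u t) x
        rw [hxh] at e2 e3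
        rw [norm_sub_rev] at e3
        have e4 : ‖f (t + τ) x - f t x‖ ≤ ∑ x ∈ F, ‖f (t + τ) x - f t x‖ :=
          Finset.single_le_sum (f := fun x => ‖f (t + τ) x - f t x‖)
            (fun _ _ => norm_nonneg _) hx
        rw [show f (t + τ) (u (t + τ)) - f t (u t) = (f (t + τ) (u (t + τ)) - f (t + τ) (u t)) +
          (f (t + τ) (u t) - f (t + τ) x) + (f t x - f t (u t)) + (f (t + τ) x - f t x) by abel]
        exact norm_add₄_le.trans (by linarith)
    _ ≤ stepanovNorm p (fun t => L (t + τ) * ‖u (t + τ) - u t‖) +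
          stepanovNorm p (fun t => L (t + τ) * h t) + stepanovNorm p (fun t => L t * h t) +
          stepanovNorm p (fun t => ∑ x ∈ F, ‖f (t + τ) x - f t x‖) :=
        (stepanovNorm_add_le hp ((hm1.add hm2).add hm3) hm4).trans <| add_le_add_left
          ((stepanovNorm_add_le hp (hm1.add hm2) hm3).trans <| add_le_add_left
            (stepanovNorm_add_le hp hm1 hm2) _) _
    _ ≤ K * δ + K * δ + K * δ + δ := by
        gcongr
        · refine (stepanovNorm_le_mul (r := r) (q := q) hLτ hum' fun t => by simp).trans ?_
          rw [hLK]
          exact mul_le_mul_right hu1 K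
        · refine (stepanovNorm_le_mul (r := r) (q := q) hLτ hhm fun t => by simp).trans ?_
          rw [hLK]
          gcongr
        · refine (stepanovNorm_le_mul (r := r) (q := q) hLm hhm fun t => by simp).trans ?_
          gcongr
        · refine (stepanovNorm_sum_le hp F hfm').trans (le_trans (Finset.sum_le_sum fun x _ => ?_) hf1)
          exact stepanovNorm_mono fun t => by simp
    _ = δ * (3 * K + 1) := by ring
    _ = ENNReal.ofReal ε := ENNReal.div_mul_cancel (by simp) hK1

/-- A bounded Stepanov almost periodic function is almost periodic of every finite order. -/
theorem IsStepanovAP.of_bounded {s q : ℝ≥0∞} (hs : 1 ≤ s) (hq : 1 ≤ q) (hq' : q ≠ ∞) {u : ℝ → E}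
    (hu : IsStepanovAP s u) {C : ℝ} (hC : ∀ t, ‖u t‖ ≤ C) : IsStepanovAP q u := by
  have hum := hu.aestronglyMeasurable
  have hC0 : 0 ≤ C := (norm_nonneg _).trans (hC 0)
  have h1 := hu.of_exponent_le hs
  refine ⟨fun a b => MemLp.of_bound hum.restrict C (ae_of_all _ hC), fun ε hε => ?_⟩
  have hq1 : 1 ≤ q.toReal := by
    rw [← ENNReal.toReal_one]; exact ENNReal.toReal_mono hq' hq
  have hq0 : 0 < q.toReal := by linarith
  -- Interpolation between `L^1` and the uniform bound `2 * C`: a factor of power `q - 1` is bounded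
  -- by `D`. The added 1 keeps `D` nonzero when `C = 0`.
  set D : ℝ≥0∞ := ENNReal.ofReal (2 * C + 1) ^ (q.toReal - 1) with hD
  have hDt : D ≠ ∞ := ENNReal.rpow_ne_top_of_nonneg (by linarith) ENNReal.ofReal_ne_top
  have hδ0 : ENNReal.ofReal ε ^ q.toReal / D ≠ 0 :=
    (ENNReal.div_pos (ENNReal.rpow_pos (by simpa using hε) ENNReal.ofReal_ne_top).ne' hDt).ne'
  have hD0 : D ≠ 0 := (ENNReal.rpow_pos (by simp; linarith) ENNReal.ofReal_ne_top).ne'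
  refine (h1.relDense hδ0).mono fun τ hτ => ?_
  change stepanovNorm q (fun t => u (t + τ) - u t) ≤ ENNReal.ofReal ε
  refine iSup_le fun x => ?_
  have hx := (eLpNorm_le_stepanovNorm 1 (fun t => u (t + τ) - u t) x).trans hτ
  rw [eLpNorm_one_eq_lintegral_enorm] at hx
  rw [eLpNorm_eq_lintegral_rpow_enorm_toReal (one_pos.trans_le hq).ne' hq', one_div,
    ENNReal.rpow_inv_le_iff hq0]
  calc ∫⁻ t in Icc x (x + 1), ‖u (t + τ) - u t‖ₑ ^ q.toReal
      ≤ ∫⁻ t in Icc x (x + 1), D * ‖u (t + τ) - u t‖ₑ := by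
        refine lintegral_mono fun t => ?_
        have hb : ‖u (t + τ) - u t‖ₑ ≤ ENNReal.ofReal (2 * C + 1) := by
          rw [← ofReal_norm]
          refine ENNReal.ofReal_le_ofReal ?_
          linarith [norm_sub_le (u (t + τ)) (u t), hC t, hC (t + τ)]
        calc ‖u (t + τ) - u t‖ₑ ^ q.toReal
            = ‖u (t + τ) - u t‖ₑ ^ (q.toReal - 1) * ‖u (t + τ) - u t‖ₑ := by
              conv_lhs => rw [← sub_add_cancel q.toReal 1]
              rw [ENNReal.rpow_add_of_nonneg _ _ (by linarith) zero_le_one, ENNReal.rpow_one]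
          _ ≤ D * ‖u (t + τ) - u t‖ₑ := by
              exact mul_le_mul_left (ENNReal.rpow_le_rpow hb (by linarith)) _
    _ = D * ∫⁻ t in Icc x (x + 1), ‖u (t + τ) - u t‖ₑ := lintegral_const_mul' _ _ hDt
    _ ≤ D * (ENNReal.ofReal ε ^ q.toReal / D) := by gcongr
    _ = ENNReal.ofReal ε ^ q.toReal := ENNReal.mul_div_cancel hD0 hDt

end Composition

/-! ### Convolution with the semigroup, and mild solutions -/

section Convolution

variable {X : Type*} [NormedAddCommGroup X] [NormedSpace ℝ X]

/-- The semigroup law bounds every increment by `M * ‖T h x - x‖` with `h ≥ 0` its length, so right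
continuity at 0 gives two-sided continuity. Truncation by `max t 0` is needed because `T` is
arbitrary at negative times. -/
theorem IsC0Semigroup.continuous_orbit {T : ℝ → X →L[ℝ] X} (hT : IsC0Semigroup T) {M : ℝ}
    (hM : ∀ t, 0 ≤ t → ‖T t‖ ≤ M) (x : X) : Continuous fun t => T (max t 0) x := by
  have hM0 : 0 ≤ M := (norm_nonneg _).trans (hM 0 le_rfl)
  have hinc : ∀ s h : ℝ, 0 ≤ s → 0 ≤ h → ‖T (s + h) x - T s x‖ ≤ M * ‖T h x - x‖ := by
    intro s h hs hh
    rw [hT.map_add s h hs hh, ContinuousLinearMap.comp_apply, ← map_sub]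
    exact ((T s).le_opNorm _).trans (mul_le_mul_of_nonneg_right (hM s hs) (norm_nonneg _))
  have hinc' : ∀ a b : ℝ, ‖T (max a 0) x - T (max b 0) x‖ ≤
      M * ‖T |max a 0 - max b 0| x - x‖ := by
    intro a b
    rcases le_total (max b 0) (max a 0) with h | h
    · rw [abs_of_nonneg (sub_nonneg.2 h)]
      have := hinc (max b 0) (max a 0 - max b 0) (le_max_right _ _) (sub_nonneg.2 h)
      rwa [add_sub_cancel] at this
    · rw [abs_of_nonpos (sub_nonpos.2 h), neg_sub, norm_sub_rev]
      have := hinc (max a 0) (max b 0 - max a 0) (le_max_right _ _) (sub_nonneg.2 h)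
      rwa [add_sub_cancel] at this
  have h0 : Tendsto (fun h => T |h| x) (𝓝 0) (𝓝 x) := by
    have h1 : Tendsto (fun h => T h x) (𝓝[≥] 0) (𝓝 x) := by
      rw [← Ioi_insert, nhdsWithin_insert, tendsto_sup]
      refine ⟨?_, hT.tendsto_zero x⟩
      rw [tendsto_pure_left]
      intro s hs
      simpa [hT.map_zero] using mem_of_mem_nhds hs
    refine h1.comp (tendsto_nhdsWithin_iff.2 ⟨?_, Eventually.of_forall fun h => abs_nonneg h⟩)
    simpa using (continuous_abs (G := ℝ)).tendsto 0
  refine continuous_iff_continuousAt.2 fun b => ?_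
  have h2 : Tendsto (fun a : ℝ => max a 0 - max b 0) (𝓝 b) (𝓝 0) := by
    have : Continuous fun a : ℝ => max a 0 - max b 0 := by fun_prop
    simpa using this.tendsto b
  have h3 : Tendsto (fun a : ℝ => M * ‖T |max a 0 - max b 0| x - x‖) (𝓝 b) (𝓝 0) := by
    simpa using (((h0.comp h2).sub_const x).norm).const_mul M
  exact tendsto_iff_norm_sub_tendsto_zero.2 (squeeze_zero (fun _ => norm_nonneg _)
    (fun a => hinc' a b) h3)

theorem IsC0Semigroup.continuous_uncurry {T : ℝ → X →L[ℝ] X} (hT : IsC0Semigroup T) {M : ℝ}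
    (hM : ∀ t, 0 ≤ t → ‖T t‖ ≤ M) : Continuous fun z : ℝ × X => T (max z.1 0) z.2 := by
  have hM0 : 0 ≤ M := (norm_nonneg _).trans (hM 0 le_rfl)
  refine continuous_prod_of_continuous_lipschitzWith' _ M.toNNReal (fun t => ?_) (hT.continuous_orbit hM)
  refine LipschitzWith.of_dist_le_mul fun x y => ?_
  simp only [dist_eq_norm]
  rw [← map_sub, Real.coe_toNNReal _ hM0]
  exact ((T (max t 0)).le_opNorm _).trans
    (mul_le_mul_of_nonneg_right (hM _ (le_max_right _ _)) (norm_nonneg _))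

theorem IsC0Semigroup.aestronglyMeasurable_convolution {T : ℝ → X →L[ℝ] X}
    (hT : IsC0Semigroup T) {M : ℝ} (hM : ∀ t, 0 ≤ t → ‖T t‖ ≤ M) {g : ℝ → X}
    (hg : AEStronglyMeasurable g volume) (t : ℝ) :
    AEStronglyMeasurable (fun s => T (t - s) (g s)) (volume.restrict (Iic t)) := by
  have h1 : AEStronglyMeasurable (fun s => ((t - s, g s) : ℝ × X)) volume :=
    (by fun_prop : Continuous fun s : ℝ => t - s).aestronglyMeasurable.prodMk hg
  refine ((hT.continuous_uncurry hM).comp_aestronglyMeasurable h1).restrict.congr ?_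
  filter_upwards [ae_restrict_mem measurableSet_Iic] with s hs
  simp only [mem_Iic] at hs
  simp [max_eq_left (sub_nonneg.2 hs)]

/-- On the window `[t - n - 1, t - n]` the semigroup has norm at most `M * exp (-δ * n)`, and the
integral of `‖g‖` is at most the `S^1` norm. -/
theorem lintegral_convolution_le {T : ℝ → X →L[ℝ] X} {M δ : ℝ}
    (hM : ∀ t, 0 ≤ t → ‖T t‖ ≤ M * Real.exp (-δ * t)) (hM0 : 0 ≤ M) (hδ : 0 < δ) (g : ℝ → X)
    (t : ℝ) :
    ∫⁻ s in Iic t, ‖T (t - s) (g s)‖ₑ ≤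
      (∑' n : ℕ, ENNReal.ofReal (M * Real.exp (-δ * n))) * stepanovNorm 1 g := by
  have hU : Iic t ⊆ ⋃ n : ℕ, Icc (t - n - 1) (t - n) := by
    intro s hs
    simp only [mem_Iic] at hs
    refine mem_iUnion.2 ⟨⌊t - s⌋₊, ?_, ?_⟩
    · linarith [Nat.lt_floor_add_one (t - s)]
    · linarith [Nat.floor_le (sub_nonneg.2 hs)]
  calc ∫⁻ s in Iic t, ‖T (t - s) (g s)‖ₑ
      = ∫⁻ s in Iic t, (Iic t).indicator (fun s => ‖T (t - s) (g s)‖ₑ) s :=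
        setLIntegral_congr_fun measurableSet_Iic fun s hs =>
          (indicator_of_mem hs (fun s => ‖T (t - s) (g s)‖ₑ)).symm
    _ ≤ ∫⁻ s in ⋃ n : ℕ, Icc (t - n - 1) (t - n),
          (Iic t).indicator (fun s => ‖T (t - s) (g s)‖ₑ) s := lintegral_mono_set hU
    _ ≤ ∑' n : ℕ, ∫⁻ s in Icc (t - n - 1) (t - n),
          (Iic t).indicator (fun s => ‖T (t - s) (g s)‖ₑ) s := lintegral_iUnion_le _ _
    _ ≤ ∑' n : ℕ, ENNReal.ofReal (M * Real.exp (-δ * n)) * stepanovNorm 1 g := by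
        refine ENNReal.tsum_le_tsum fun n => ?_
        have h1 := eLpNorm_le_stepanovNorm 1 g (t - n - 1)
        rw [eLpNorm_one_eq_lintegral_enorm, sub_add_cancel] at h1
        calc _ ≤ ∫⁻ s in Icc (t - n - 1) (t - n),
                ENNReal.ofReal (M * Real.exp (-δ * n)) * ‖g s‖ₑ := by
              refine setLIntegral_mono' measurableSet_Icc fun s hs => ?_
              by_cases hst : s ∈ Iic t
              · rw [indicator_of_mem hst]
                have hT := hM (t - s) (sub_nonneg.2 hst)
                have hexp : Real.exp (-δ * (t - s)) ≤ Real.exp (-δ * n) :=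
                  Real.exp_le_exp.2 (by nlinarith [hs.2])
                rw [← ofReal_norm, ← ofReal_norm, ← ENNReal.ofReal_mul (by positivity)]
                refine ENNReal.ofReal_le_ofReal (((T (t - s)).le_opNorm _).trans ?_)
                gcongr
                exact hT.trans (mul_le_mul_of_nonneg_left hexp hM0)
              · rw [indicator_of_notMem hst]
                exact zero_le
          _ = ENNReal.ofReal (M * Real.exp (-δ * n)) * ∫⁻ s in Icc (t - n - 1) (t - n), ‖g s‖ₑ :=
              lintegral_const_mul' _ _ ENNReal.ofReal_ne_top
          _ ≤ _ := by gcongr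
    _ = _ := ENNReal.tsum_mul_right

theorem tsum_ofReal_exp_lt_top (M : ℝ) {δ : ℝ} (hδ : 0 < δ) (hM0 : 0 ≤ M) :
    (∑' n : ℕ, ENNReal.ofReal (M * Real.exp (-δ * n))) < ∞ := by
  have hs : Summable fun n : ℕ => M * Real.exp (-δ * n) := by
    refine Summable.mul_left M ?_
    have : ∀ n : ℕ, Real.exp (-δ * n) = Real.exp (-δ) ^ n := fun n => by
      rw [← Real.exp_nat_mul, mul_comm]
    simp only [this]
    exact summable_geometric_of_lt_one (Real.exp_pos _).le (by simpa using hδ)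
  rw [← ENNReal.ofReal_tsum_of_nonneg (fun n => by positivity) hs]
  exact ENNReal.ofReal_lt_top

/-- Convolution with an exponentially stable semigroup maps Stepanov almost periodic functions to
Bohr almost periodic ones. -/
theorem IsStepanovAP.convolution {T : ℝ → X →L[ℝ] X} (hT : IsC0Semigroup T)
    (hstab : IsExpStable T) {p : ℝ≥0∞} (hp : 1 ≤ p) {g : ℝ → X} (hg : IsStepanovAP p g) :
    (∀ t, IntegrableOn (fun s => T (t - s) (g s)) (Iic t) volume) ∧
      IsBohrAP fun t => ∫ s in Iic t, T (t - s) (g s) := by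
  obtain ⟨M, δ, hδ, hM⟩ := hstab
  replace hg := hg.of_exponent_le hp
  have hM0 : 0 ≤ M := by simpa using (norm_nonneg _).trans (hM 0 le_rfl)
  have hMb : ∀ t, 0 ≤ t → ‖T t‖ ≤ M := fun t ht =>
    (hM t ht).trans (mul_le_of_le_one_right hM0 (Real.exp_le_one_iff.2 (by nlinarith)))
  have hgm := hg.aestronglyMeasurable
  set C := ∑' n : ℕ, ENNReal.ofReal (M * Real.exp (-δ * n)) with hC
  have hCt : C ≠ ∞ := (tsum_ofReal_exp_lt_top M hδ hM0).ne
  have hint : ∀ {g : ℝ → X}, AEStronglyMeasurable g volume → stepanovNorm 1 g < ∞ →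
      ∀ t, IntegrableOn (fun s => T (t - s) (g s)) (Iic t) volume := fun {g} hgm hg t =>
    ⟨hT.aestronglyMeasurable_convolution hMb hgm t,
      (lintegral_convolution_le hM hM0 hδ g t).trans_lt (ENNReal.mul_lt_top hCt.lt_top hg)⟩
  have hgt := hg.stepanovNorm_lt_top le_rfl
  have hgi := hint hgm hgt
  refine ⟨hgi, ?_⟩
  set Γ : ℝ → X := fun t => ∫ s in Iic t, T (t - s) (g s) with hΓ
  have htrans : ∀ t τ, Γ (t + τ) = ∫ s in Iic t, T (t - s) (g (s + τ)) := by
    intro t τ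
    have he := measurableEmbedding_addRight τ
    have hm := (measurePreserving_add_right volume τ).restrict_preimage_emb he (Iic (t + τ))
    have hpre : (fun x => x + τ) ⁻¹' Iic (t + τ) = Iic t := by ext; simp
    rw [hpre] at hm
    rw [hΓ]
    beta_reduce
    rw [← hm.map_eq, he.integral_map]
    simp
  -- This one estimate yields both continuity (`τ → 0`) and the almost periods of `Γ`.
  have hbound : ∀ τ t, edist (Γ t) (Γ (t + τ)) ≤ C * stepanovDist 1 (fun t => g (t + τ)) g := by
    intro τ t
    have hgm' := aestronglyMeasurable_comp_add_right hgm τ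
    rw [edist_comm, edist_eq_enorm_sub, htrans, hΓ]
    beta_reduce
    rw [← integral_sub (hint hgm' (by rwa [stepanovNorm_comp_add_right]) t) (hgi t)]
    refine (enorm_integral_le_lintegral_enorm _).trans ?_
    simp only [← map_sub]
    exact lintegral_convolution_le hM hM0 hδ (fun s => g (s + τ) - g s) t
  refine ⟨continuous_iff_continuousAt.2 fun t => ?_, fun ε hε => ?_⟩
  · have h1 : Tendsto (fun τ => C * stepanovDist 1 (fun t => g (t + τ)) g) (𝓝 0) (𝓝 0) := by
      simpa using ENNReal.Tendsto.const_mul (hg.tendsto_stepanovDist le_rfl ENNReal.one_ne_top)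
        (Or.inr hCt)
    have h2 : Tendsto (fun x => x - t) (𝓝 t) (𝓝 0) := by
      simpa using (continuous_sub_right t).tendsto t
    refine tendsto_iff_edist_tendsto_0.2 (tendsto_of_tendsto_of_tendsto_of_le_of_le
      tendsto_const_nhds (h1.comp h2) (fun _ => zero_le) fun x => ?_)
    have := hbound (x - t) t
    rwa [add_sub_cancel, edist_comm] at this
  -- Halving `ε` gives the strict inequality for the supremum; `C + 1` avoids division by zero.
  · have hη0 : ENNReal.ofReal (ε / 2) / (C + 1) ≠ 0 :=
      (ENNReal.div_pos (by simpa using hε) (by finiteness)).ne'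
    refine (hg.relDense hη0).mono fun τ hτ => ?_
    have h1 : ⨆ t, edist (Γ t) (Γ (t + τ)) ≤ ENNReal.ofReal (ε / 2) := by
      refine iSup_le fun t => (hbound τ t).trans ?_
      calc _ ≤ (C + 1) * (ENNReal.ofReal (ε / 2) / (C + 1)) :=
            mul_le_mul' le_self_add hτ
        _ = ENNReal.ofReal (ε / 2) := ENNReal.mul_div_cancel (by simp) (by finiteness)
    exact h1.trans_lt ((ENNReal.ofReal_lt_ofReal_iff hε).2 (by linarith))

/-- A bounded mild solution is given by the variation of constants formula from `-∞`. -/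
theorem IsMildSolution.eq_gammaOp {T : ℝ → X →L[ℝ] X} (hstab : IsExpStable T)
    {f : ℝ → X → X} {u : ℝ → X} (hu : IsMildSolution T f u) {B : ℝ} (hB : ∀ t, ‖u t‖ ≤ B)
    (hd : GammaDefined T f u) : u = gammaOp T f u := by
  obtain ⟨M, δ, hδ, hM⟩ := hstab
  have hM0 : 0 ≤ M := by simpa using (norm_nonneg _).trans (hM 0 le_rfl)
  ext t
  have h1 : Tendsto (fun a => ∫ s in a..t, T (t - s) (f s (u s))) atBot (𝓝 (gammaOp T f u t)) :=
    intervalIntegral_tendsto_integral_Iic t (hd t) tendsto_id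
  -- As `a → -∞` boundedness of `u` and exponential decay remove the initial value from the mild
  -- formula.
  have h2 : Tendsto (fun a : ℝ => T (t - a) (u a)) atBot (𝓝 0) := by
    have h3 : Tendsto (fun a : ℝ => M * Real.exp (-δ * (t - a)) * B) atBot (𝓝 0) := by
      have h4 : Tendsto (fun a : ℝ => -δ * (t - a)) atBot atBot := by
        have : (fun a : ℝ => -δ * (t - a)) = fun a => δ * a + -δ * t := by ext; ring
        rw [this]
        exact tendsto_atBot_add_const_right _ _ (tendsto_id.const_mul_atBot hδ)
      simpa using ((Real.tendsto_exp_atBot.comp h4).const_mul M).mul_const B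
    refine squeeze_zero_norm' ?_ h3
    filter_upwards [eventually_le_atBot t] with a ha
    exact ((T (t - a)).le_opNorm _).trans
      (mul_le_mul (hM _ (sub_nonneg.2 ha)) (hB a) (norm_nonneg _) (by positivity))
  have h5 := h2.add h1
  rw [zero_add] at h5
  refine tendsto_nhds_unique (tendsto_const_nhds.congr' ?_) h5
  filter_upwards [eventually_le_atBot t] with a ha
  exact (hu.2 a t ha).2

end Convolution

end StepanovAP

/-! ### Proof of the theorem -/

theorem mainTheorem11
    {X : Type*} [NormedAddCommGroup X] [NormedSpace ℝ X] [CompleteSpace X]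
    (A : X →ₗ.[ℝ] X) (T : ℝ → X →L[ℝ] X)
    (hT : IsC0Semigroup T) (hA : IsGenerator A T) (hstab : IsExpStable T)
    (p q r : ℝ≥0∞) (hp : 1 ≤ p) (hq : 1 ≤ q) (hr : 1 ≤ r) (hq_top : q ≠ ∞)
    (hpqr : p⁻¹ = q⁻¹ + r⁻¹)
    (f : ℝ → X → X) (hf : IsParamStepanovAP p f) (hLip : LipCondition r f) :
    (∀ u : ℝ → X, IsStepanovAP q u → GammaDefined T f u ∧ IsBohrAP (gammaOp T f u)) ∧
    (p⁻¹ + r⁻¹ ≤ 1 →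
      ∀ u : ℝ → X, IsStepanovAP p u → GammaDefined T f u ∧ IsBohrAP (gammaOp T f u)) ∧
    (∀ u : ℝ → X, IsMildSolution T f u → (∃ C : ℝ, ∀ t : ℝ, ‖u t‖ ≤ C) →
      ∀ s : ℝ≥0∞, 1 ≤ s → ¬ IsPurelyStepanovAP s u) := by
  have hp_top : p ≠ ∞ := by
    rintro rfl
    rw [ENNReal.inv_top, eq_comm, add_eq_zero, ENNReal.inv_eq_zero] at hpqr
    exact hq_top hpqr.1
  have h1 : ∀ u : ℝ → X, IsStepanovAP q u → GammaDefined T f u ∧ IsBohrAP (gammaOp T f u) := by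
    intro u hu
    have : ENNReal.HolderTriple r q p := ⟨by rw [hpqr, add_comm]⟩
    exact (hf.comp hp hp_top hq hq_top hLip hu).convolution hT hstab hp
  refine ⟨h1, fun hpr u hu => ?_, fun u hu ⟨B, hB⟩ s hs ⟨hus, hnot⟩ => ?_⟩
  -- With only `S^p` regularity of `u`, Hölder lands in order `(p⁻¹ + r⁻¹)⁻¹`. The hypothesis makes
  -- this order at least 1, and it is at most `p`, so `f` is almost periodic of this order too.
  · have hp1 : 1 ≤ (p⁻¹ + r⁻¹)⁻¹ := ENNReal.one_le_inv.2 hpr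
    have hp1p : (p⁻¹ + r⁻¹)⁻¹ ≤ p := ENNReal.inv_le_iff_inv_le.2 le_self_add
    have : ENNReal.HolderTriple r p (p⁻¹ + r⁻¹)⁻¹ := ⟨by rw [inv_inv, add_comm]⟩
    have hf' : IsParamStepanovAP (p⁻¹ + r⁻¹)⁻¹ f := fun x => (hf x).of_exponent_le hp1p
    exact (hf'.comp hp1 (ne_top_of_le_ne_top hp_top hp1p) hp hp_top hLip hu).convolution
      hT hstab hp1
  · obtain ⟨hd, hb⟩ := h1 u (hus.of_bounded hs hq hq_top hB)
    rw [← hu.eq_gammaOp hstab hB hd] at hb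
    exact hnot hb
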